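/- Let $\mathcal A$ be a nonzero (not necessarily unital) complex $C^*$-algebra and let $a,b\in\mathcal A$. Write $\mathbb T=\{\lambda\in\mathbb C:|\lambda|=1\}$. A state of $\mathcal A$ is a linear functional $\varphi:\mathcal A\to\mathbb C$ of norm one with $\varphi(c^*c)\ge 0$ for all $c\in\mathcal A$; a representation of $\mathcal A$ on a complex Hilbert space $\mathcal H$ is a $*$-homomorphism $\pi:\mathcal A\to\mathbb B(\mathcal H)$ into the bounded linear operators on $\mathcal H$. Then the following statements are equivalent: (i) $a\parallel b$, that is, $\|a+\lambda b\|=\|a\|+\|b\|$ for some $\lambda\in\mathbb T$; (ii) there exist a state $\varphi$ of $\mathcal A$ and $\lambda\in\mathbb T$ such that $\varphi(a^*b)=\lambda\|a\|\|b\|$; (iii) there exist a complex Hilbert space $\mathcal H$ with inner product $(\cdot\mid\cdot)$ (linear in the first variable), a representation $\pi:\mathcal A\to\mathbb B(\mathcal H)$, a unit vector $\xi\in\mathcal H$ and $\lambda\in\mathbb T$ such that $\|\pi(a)\xi\|=\|a\|$ and $(\pi(a)\xi\mid\pi(b)\xi)=\lambda\|a\|\|b\|$. -/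

import Mathlib

universe u v

open scoped ComplexOrder

namespace CStarParallel

/-- `x ∥ y` in a complex normed space: `‖x + l y‖ = ‖x‖ + ‖y‖` for some unimodular `l`. -/
def Parallel {V : Type*} [NormedAddCommGroup V] [NormedSpace ℂ V] (x y : V) : Prop :=
  ∃ l : ℂ, ‖l‖ = 1 ∧ ‖x + l • y‖ = ‖x‖ + ‖y‖

/-- A state of a (not necessarily unital) C⋆-algebra: a linear functional of norm one that is
nonnegative on the positive elements, that is, on the elements of the form `c⋆ c`. -/
def IsState {A : Type*} [NonUnitalCStarAlgebra A] (φ : A →L[ℂ] ℂ) : Prop :=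
  ‖φ‖ = 1 ∧ ∀ c : A, 0 ≤ φ (star c * c)

end CStarParallel

namespace CStarParallel

/-! Each implication saturates an inequality. If `c = a + l • b` has norm `‖a‖ + ‖b‖`, a state
norming `star c * c` must attain the bound on each of the four terms of its expansion, so `φ (star a
* (l • b)) = ‖a‖ * ‖b‖`. Given (ii), Cauchy–Schwarz yields a state with also `φ (star a * a) = ‖a‖ ^
2`; GNS for its extension to the unitization supplies the unit vector. Given (iii), `π (a + l • b)
ξ` has norm at least `‖a‖ + ‖b‖`, and `π` is contractive. -/

lemma eq_ofReal_of_norm_le_of_le_re {z : ℂ} {r : ℝ} (hz : ‖z‖ ≤ r) (hr : r ≤ z.re) :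
    z = r := by
  have h₁ : z.re = r := le_antisymm ((Complex.re_le_norm z).trans hz) hr
  have h₂ : ‖z‖ = r := le_antisymm hz (hr.trans (Complex.re_le_norm z))
  have h₃ := Complex.sq_norm z
  rw [Complex.normSq_apply, h₁, h₂] at h₃
  have h₄ : z.im = 0 := by
    have : z.im * z.im = 0 := by linarith [sq r]
    simpa using this
  exact Complex.ext (by simp [h₁]) (by simp [h₄])

section Unital

variable {B : Type*} [CStarAlgebra B] [Nontrivial B]

/-- A unital functional of norm at most one is real on self-adjoint elements. -/
lemma im_apply_eq_zero_of_isSelfAdjoint {f : B →L[ℂ] ℂ} (hf : ‖f‖ ≤ 1) (hf₁ : f 1 = 1) {h : B}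
    (hh : IsSelfAdjoint h) : (f h).im = 0 := by
  -- Test `f` on `h + it`: the `t ^ 2` terms cancel, and a linear function of `t` bounded above on
  -- all of `ℝ` has slope zero.
  have key (t : ℝ) : 2 * t * (f h).im ≤ ‖h‖ ^ 2 := by
    set y : B := h + (t * Complex.I) • (1 : B)
    have hy : star y * y = h * h + ((t : ℂ) ^ 2) • (1 : B) := by
      have : (Complex.I * Complex.I) = -1 := Complex.I_mul_I
      simp only [y, star_add, hh.star_eq, star_smul, star_one, add_mul, mul_add, smul_mul_assoc,
        mul_smul_comm, one_mul, mul_one]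
      simp only [star_mul', Complex.star_def, Complex.conj_ofReal, Complex.conj_I, smul_add,
        smul_smul]
      have e : (t : ℂ) * Complex.I * (t * -Complex.I) = (t : ℂ) ^ 2 := by
        linear_combination (-(t : ℂ) ^ 2) * this
      rw [e]
      module
    have hy' : ‖y‖ ^ 2 ≤ ‖h‖ ^ 2 + t ^ 2 := by
      rw [sq, ← CStarRing.norm_star_mul_self, hy]
      refine (norm_add_le _ _).trans ?_
      gcongr
      · exact (norm_mul_le _ _).trans (sq ‖h‖).ge
      · simp [norm_smul]
    have hfy : f y = f h + t * Complex.I := by simp [y, hf₁]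
    have hle : ‖f y‖ ≤ ‖y‖ := by simpa using f.le_of_opNorm_le hf y
    have him : |(f y).im| ≤ ‖y‖ := (Complex.abs_im_le_norm _).trans hle
    have him' : ((f h).im + t) ^ 2 ≤ ‖y‖ ^ 2 := by
      rw [hfy] at him
      have := sq_le_sq' (neg_le_of_abs_le him) (le_of_abs_le him)
      simpa using this
    nlinarith [sq_nonneg (f h).im]
  by_contra hne
  have := key ((‖h‖ ^ 2 + 1) / (2 * (f h).im))
  have e : 2 * ((‖h‖ ^ 2 + 1) / (2 * (f h).im)) * (f h).im = ‖h‖ ^ 2 + 1 := by field_simp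
  linarith

variable [PartialOrder B] [StarOrderedRing B]

/-- A unital functional of norm at most one is positive. -/
lemma apply_nonneg_of_norm_le_one {f : B →L[ℂ] ℂ} (hf : ‖f‖ ≤ 1) (hf₁ : f 1 = 1) {x : B}
    (hx : 0 ≤ x) : 0 ≤ f x := by
  have him := im_apply_eq_zero_of_isSelfAdjoint hf hf₁ (IsSelfAdjoint.of_nonneg hx)
  have hle : ‖algebraMap ℝ B ‖x‖ - x‖ ≤ ‖x‖ := by
    refine (CStarAlgebra.norm_le_norm_of_nonneg_of_le (b := algebraMap ℝ B ‖x‖)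
      (sub_nonneg.2 (IsSelfAdjoint.of_nonneg hx).le_algebraMap_norm_self)
      (sub_le_self _ hx)).trans ?_
    simp
  have hle' : ‖f (algebraMap ℝ B ‖x‖ - x)‖ ≤ ‖x‖ := by
    simpa using (f.le_of_opNorm_le hf _).trans ((one_mul _).trans_le hle)
  have hfx : f (algebraMap ℝ B ‖x‖ - x) = ‖x‖ - f x := by
    rw [map_sub, Algebra.algebraMap_eq_smul_one, ← Complex.coe_smul, map_smul, hf₁]
    simp
  rw [hfx] at hle'
  have hre := (Complex.re_le_norm _).trans hle'
  simp only [Complex.sub_re, Complex.ofReal_re] at hre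
  exact Complex.nonneg_iff.2 ⟨by linarith, him.symm⟩

/-- For positive `x` the norm is a spectral value, and adding `1` shifts the spectrum. -/
lemma norm_one_add_of_nonneg {x : B} (hx : 0 ≤ x) : ‖1 + x‖ = 1 + ‖x‖ := by
  refine le_antisymm ((norm_add_le _ _).trans_eq (by simp)) ?_
  have h := CStarAlgebra.norm_mem_spectrum_of_nonneg hx
  have h' : 1 + ‖x‖ ∈ spectrum ℝ (1 + x) := by
    simpa [add_comm] using spectrum.add_mem_add_iff (r := ‖x‖) (s := (1 : ℝ)) |>.2 h
  refine (le_abs_self _).trans ?_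
  simpa using spectrum.norm_le_norm_of_mem h'

/-- A positive element of a unital C⋆-algebra is normed by a unital positive functional. -/
lemma exists_unital_apply_eq_norm {x : B} (hx : 0 ≤ x) :
    ∃ f : B →L[ℂ] ℂ, ‖f‖ ≤ 1 ∧ (∀ y, 0 ≤ y → 0 ≤ f y) ∧ f x = ‖x‖ := by
  -- Norming `1 + x` instead of `x` forces both `f 1 = 1` and `f x = ‖x‖`; the former gives
  -- positivity.
  obtain ⟨f, hf, hfx⟩ := exists_dual_vector'' ℂ (1 + x)
  have h₁ : ‖f 1‖ ≤ 1 := by simpa using f.le_of_opNorm_le hf 1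
  have h₂ : ‖f x‖ ≤ ‖x‖ := by simpa using f.le_of_opNorm_le hf x
  have hre : (f 1).re + (f x).re = 1 + ‖x‖ := by
    rw [← Complex.add_re, ← map_add, hfx, norm_one_add_of_nonneg hx]
    simp
  have hf₁ : f 1 = (1 : ℝ) := eq_ofReal_of_norm_le_of_le_re h₁ (by
    linarith [(Complex.re_le_norm (f x)).trans h₂])
  exact ⟨f, hf, fun y hy => apply_nonneg_of_norm_le_one hf (by simpa using hf₁) hy,
    eq_ofReal_of_norm_le_of_le_re h₂ (by linarith [(Complex.re_le_norm (f 1)).trans h₁])⟩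

end Unital

section NonUnital

variable {A : Type*} [NonUnitalCStarAlgebra A]

/-- Every nonzero `star c * c` is normed by a state. -/
lemma exists_isState_apply_star_mul_self {c : A} (hc : c ≠ 0) :
    ∃ φ : A →L[ℂ] ℂ, IsState φ ∧ φ (star c * c) = ‖c‖ ^ 2 := by
  let _ : PartialOrder (Unitization ℂ A) := CStarAlgebra.spectralOrder _
  have : StarOrderedRing (Unitization ℂ A) := CStarAlgebra.spectralOrderedRing _
  obtain ⟨f, hf, hpos, hfc⟩ := exists_unital_apply_eq_norm
    (star_mul_self_nonneg (c : Unitization ℂ A))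
  have hb (x : A) : ‖f x‖ ≤ 1 * ‖x‖ := by
    simpa [Unitization.norm_inr] using f.le_of_opNorm_le hf (x : Unitization ℂ A)
  let φ : A →L[ℂ] ℂ :=
    (f.toLinearMap ∘ₗ (Unitization.inrHom ℂ ℂ A)).mkContinuous 1 hb
  have hφ (x : A) : φ x = f x := rfl
  have hφc : φ (star c * c) = ‖c‖ ^ 2 := by
    rw [hφ, Unitization.inr_mul, Unitization.inr_star, hfc, CStarRing.norm_star_mul_self,
      Unitization.norm_inr]
    push_cast
    ring
  refine ⟨φ, ⟨le_antisymm (LinearMap.mkContinuous_norm_le _ zero_le_one _) ?_, fun x => ?_⟩, hφc⟩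
  · have h := φ.le_opNorm (star c * c)
    rw [hφc, CStarRing.norm_star_mul_self] at h
    have hc' : 0 < ‖c‖ * ‖c‖ := by positivity
    refine le_of_mul_le_mul_right ?_ hc'
    simpa [sq] using h
  · rw [hφ, Unitization.inr_mul, Unitization.inr_star]
    exact hpos _ (star_mul_self_nonneg _)

variable {φ : A →L[ℂ] ℂ}

lemma IsState.norm_apply_le (hφ : IsState φ) (x : A) : ‖φ x‖ ≤ ‖x‖ := by
  simpa using φ.le_of_opNorm_le hφ.1.le x

lemma IsState.norm_sq_apply_star_mul_le (hφ : IsState φ) (x y : A) :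
    ‖φ (star x * y)‖ ^ 2 ≤ (φ (star x * x)).re * (φ (star y * y)).re := by
  let _ : PartialOrder A := CStarAlgebra.spectralOrder _
  have : StarOrderedRing A := CStarAlgebra.spectralOrderedRing _
  let f : A →ₚ[ℂ] ℂ := .mk₀ φ.toLinearMap fun x hx => by
    obtain ⟨y, rfl⟩ := CStarAlgebra.nonneg_iff_eq_star_mul_self.1 hx
    exact hφ.2 y
  have h := norm_inner_le_norm (𝕜 := ℂ) (f.toPreGNS x) (f.toPreGNS y)
  have hn (z : A) : ‖f.toPreGNS z‖ ^ 2 = (φ (star z * z)).re := by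
    have := f.preGNS_norm_sq (f.toPreGNS z)
    exact_mod_cast congrArg Complex.re this
  rw [← hn, ← hn, ← mul_pow]
  exact pow_le_pow_left₀ (norm_nonneg _) h 2

/-- Cauchy–Schwarz against the missing unit, replaced by an approximate unit. -/
lemma IsState.norm_sq_apply_le (hφ : IsState φ) (x : A) :
    ‖φ x‖ ^ 2 ≤ (φ (star x * x)).re := by
  let _ : PartialOrder A := CStarAlgebra.spectralOrder _
  have : StarOrderedRing A := CStarAlgebra.spectralOrderedRing _
  have hl := CStarAlgebra.increasingApproximateUnit A
  have ht : Filter.Tendsto (fun e => ‖φ (e * x)‖ ^ 2) (CStarAlgebra.approximateUnit A)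
      (nhds (‖φ x‖ ^ 2)) :=
    (((φ.continuous.tendsto _).comp (hl.tendsto_mul_right x)).norm).pow 2
  refine le_of_tendsto ht ?_
  filter_upwards [hl.eventually_star_eq, hl.eventually_norm] with e he hn
  have h := hφ.norm_sq_apply_star_mul_le e x
  rw [he] at h
  refine h.trans (mul_le_of_le_one_left (Complex.nonneg_iff.1 (hφ.2 x)).1 ?_)
  refine (Complex.re_le_norm _).trans ((hφ.norm_apply_le _).trans ((norm_mul_le _ _).trans ?_))
  exact mul_le_one₀ hn (norm_nonneg _) hn

/-- The extension of a functional to the unitization taking the value `1` at `1`. -/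
noncomputable def unitalExtension (φ : A →L[ℂ] ℂ) : Unitization ℂ A →ₗ[ℂ] ℂ where
  toFun x := x.fst + φ x.snd
  map_add' x y := by simp; ring
  map_smul' r x := by simp; ring

/-- Complete the square; the remainder is nonnegative by `IsState.norm_sq_apply_le`. -/
lemma IsState.unitalExtension_star_mul_self_nonneg (hφ : IsState φ) (x : Unitization ℂ A) :
    0 ≤ unitalExtension φ (star x * x) := by
  let _ : PartialOrder A := CStarAlgebra.spectralOrder _
  have : StarOrderedRing A := CStarAlgebra.spectralOrderedRing _
  let f : A →ₚ[ℂ] ℂ := .mk₀ φ.toLinearMap fun x hx => by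
    obtain ⟨y, rfl⟩ := CStarAlgebra.nonneg_iff_eq_star_mul_self.1 hx
    exact hφ.2 y
  have hstar (y : A) : φ (star y) = star (φ y) := map_star f y
  have hsq := hφ.norm_sq_apply_le x.snd
  obtain ⟨-, him⟩ := Complex.nonneg_iff.1 (hφ.2 x.snd)
  have hval : unitalExtension φ (star x * x)
      = star (x.fst + φ x.snd) * (x.fst + φ x.snd)
        + ((φ (star x.snd * x.snd)) - star (φ x.snd) * φ x.snd) := by
    simp [unitalExtension, hstar]
    ring
  rw [hval]
  refine add_nonneg (star_mul_self_nonneg _) ?_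
  rw [Complex.star_def, Complex.conj_mul', Complex.nonneg_iff, ← Complex.ofReal_pow]
  simp only [Complex.sub_re, Complex.sub_im, Complex.ofReal_re, Complex.ofReal_im, ← him]
  exact ⟨sub_nonneg.2 hsq, by simp⟩

/-- A state of a C⋆-algebra is a vector state of some representation. -/
lemma IsState.exists_representation {A : Type u} [NonUnitalCStarAlgebra A] {φ : A →L[ℂ] ℂ}
    (hφ : IsState φ) :
    ∃ (H : Type u) (_ : NormedAddCommGroup H) (_ : InnerProductSpace ℂ H)
      (_ : CompleteSpace H) (π : A →⋆ₙₐ[ℂ] (H →L[ℂ] H)) (ξ : H),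
      ‖ξ‖ = 1 ∧ ∀ x y, inner ℂ (π x ξ) (π y ξ) = φ (star x * y) := by
  let _ : PartialOrder (Unitization ℂ A) := CStarAlgebra.spectralOrder _
  have : StarOrderedRing (Unitization ℂ A) := CStarAlgebra.spectralOrderedRing _
  let f : Unitization ℂ A →ₚ[ℂ] ℂ := .mk₀ (unitalExtension φ) fun x hx => by
    obtain ⟨y, rfl⟩ := CStarAlgebra.nonneg_iff_eq_star_mul_self.1 hx
    exact hφ.unitalExtension_star_mul_self_nonneg y
  have hf (x : Unitization ℂ A) : f x = x.fst + φ x.snd := rfl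
  refine ⟨f.GNS, inferInstance, inferInstance, inferInstance,
    f.gnsNonUnitalStarAlgHom.comp (Unitization.inrNonUnitalStarAlgHom ℂ A),
    -- The vector is the class of the adjoined unit, where the extension takes the value `1`.
    (f.toPreGNS 1 : f.PreGNS), ?_, fun x y => ?_⟩
  · rw [UniformSpace.Completion.norm_coe, f.preGNS_norm_def]
    simp [hf]
  · simp [f.preGNS_inner_def, hf, ← Unitization.inr_mul, ← Unitization.inr_star]

end NonUnital

/-- Serves to move the GNS space from the universe of the algebra to any larger one. -/
noncomputable instance instInnerProductSpaceULift {H : Type*} [NormedAddCommGroup H] [InnerProductSpace ℂ H] :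
    InnerProductSpace ℂ (ULift H) where
  inner x y := inner ℂ x.down y.down
  norm_sq_eq_re_inner x := norm_sq_eq_re_inner x.down
  conj_inner_symm x y := inner_conj_symm x.down y.down
  add_left x y z := inner_add_left x.down y.down z.down
  smul_left x y r := inner_smul_left x.down y.down r

lemma IsState.exists_representation_ulift {A : Type u} [NonUnitalCStarAlgebra A] {φ : A →L[ℂ] ℂ}
    (hφ : IsState φ) :
    ∃ (H : Type (max u v)) (_ : NormedAddCommGroup H) (_ : InnerProductSpace ℂ H)
      (_ : CompleteSpace H) (π : A →⋆ₙₐ[ℂ] (H →L[ℂ] H)) (ξ : H),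
      ‖ξ‖ = 1 ∧ ∀ x y, inner ℂ (π x ξ) (π y ξ) = φ (star x * y) := by
  obtain ⟨H, _, _, _, π, ξ, hξ, h⟩ := hφ.exists_representation
  let e : H ≃ₗᵢ[ℂ] ULift.{v} H := (LinearIsometryEquiv.ulift ℂ H).symm
  have : CompleteSpace (ULift.{v} H) := e.toIsometryEquiv.completeSpace_iff.1 inferInstance
  refine ⟨ULift.{v} H, inferInstance, inferInstance, inferInstance,
    (e.conjStarAlgEquiv : (H →L[ℂ] H) →⋆ₙₐ[ℂ] (ULift.{v} H →L[ℂ] ULift.{v} H)).comp π,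
    e ξ, by rw [e.norm_map, hξ], fun x y => ?_⟩
  rw [← h x y, ← e.inner_map_map]
  simp

section Parallel

variable {A : Type*} [NonUnitalCStarAlgebra A]

lemma exists_isState [Nontrivial A] : ∃ φ : A →L[ℂ] ℂ, IsState φ := by
  obtain ⟨c, hc⟩ := exists_ne (0 : A)
  obtain ⟨φ, hφ, -⟩ := exists_isState_apply_star_mul_self hc
  exact ⟨φ, hφ⟩

lemma exists_isState_of_parallel [Nontrivial A] {a b : A} (h : Parallel a b) :
    ∃ (φ : A →L[ℂ] ℂ) (l : ℂ), IsState φ ∧ ‖l‖ = 1 ∧ φ (star a * b) = l * ‖a‖ * ‖b‖ := by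
  obtain ⟨l, hl, hab⟩ := h
  by_cases hc : a + l • b = 0
  · obtain ⟨φ, hφ⟩ := exists_isState (A := A)
    have ha : a = 0 := by
      rw [hc, norm_zero] at hab
      exact norm_eq_zero.1 (by linarith [norm_nonneg a, norm_nonneg b])
    exact ⟨φ, 1, hφ, by simp, by simp [ha]⟩
  obtain ⟨φ, hφ, hφc⟩ := exists_isState_apply_star_mul_self hc
  have hll : star l * l = 1 := by
    rw [Complex.star_def, Complex.conj_mul', hl]; simp
  have hbound (x y : A) : ‖φ (star x * y)‖ ≤ ‖x‖ * ‖y‖ :=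
    (hφ.norm_apply_le _).trans ((norm_mul_le _ _).trans_eq (by rw [norm_star]))
  have hlb : ‖l • b‖ = ‖b‖ := by rw [norm_smul, hl, one_mul]
  have h₁ := (Complex.re_le_norm _).trans (hbound a a)
  have h₂ := (Complex.re_le_norm _).trans (hbound (l • b) (l • b))
  have h₃ := (Complex.re_le_norm _).trans (hbound (l • b) a)
  have h₄ := hbound a (l • b)
  rw [hlb] at h₂ h₃ h₄
  have hsum : (φ (star a * a)).re + (φ (star a * (l • b))).re + (φ (star (l • b) * a)).re
      + (φ (star (l • b) * (l • b))).re = (‖a‖ + ‖b‖) ^ 2 := by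
    have := congrArg Complex.re hφc
    rw [hab, star_add, add_mul, mul_add, mul_add, ← Complex.ofReal_pow, Complex.ofReal_re] at this
    simp only [map_add, Complex.add_re] at this
    linarith
  -- The other three terms total at most `‖a‖ ^ 2 + ‖a‖ * ‖b‖ + ‖b‖ ^ 2`, which leaves at least `‖a‖
  -- * ‖b‖` for this one.
  have h₅ := eq_ofReal_of_norm_le_of_le_re h₄ (by nlinarith)
  refine ⟨φ, star l, hφ, by rw [norm_star, hl], ?_⟩
  rw [mul_smul_comm, map_smul, smul_eq_mul, Complex.ofReal_mul] at h₅
  linear_combination star l * h₅ - φ (star a * b) * hll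

lemma parallel_of_representation {H : Type*} [NormedAddCommGroup H] [InnerProductSpace ℂ H]
    [CompleteSpace H] {a b : A} (π : A →⋆ₙₐ[ℂ] (H →L[ℂ] H)) {ξ : H} {l : ℂ} (hξ : ‖ξ‖ = 1)
    (hl : ‖l‖ = 1) (ha : ‖π a ξ‖ = ‖a‖)
    (hab : inner ℂ (π b ξ) (π a ξ) = l * ‖a‖ * ‖b‖) : Parallel a b := by
  refine ⟨l, hl, le_antisymm ((norm_add_le _ _).trans_eq (by simp [norm_smul, hl])) ?_⟩
  by_cases ha₀ : a = 0
  · simp [ha₀, norm_smul, hl]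
  have hll : star l * l = 1 := by
    rw [Complex.star_def, Complex.conj_mul', hl]; simp
  have hπ (x : A) : ‖π x ξ‖ ≤ ‖x‖ := by
    have := (π x).le_of_opNorm_le (NonUnitalStarAlgHom.norm_apply_le π x) ξ
    simpa [hξ] using this
  have hb : ‖b‖ ≤ ‖π b ξ‖ := by
    have := norm_inner_le_norm (𝕜 := ℂ) (π b ξ) (π a ξ)
    rw [hab, ha] at this
    simp only [norm_mul, hl, one_mul, Complex.norm_real, norm_norm] at this
    rw [mul_comm] at this
    exact le_of_mul_le_mul_right this (norm_pos_iff.2 ha₀)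
  have hin : inner ℂ (l • π b ξ) (π a ξ) = ((‖a‖ * ‖b‖ : ℝ) : ℂ) := by
    rw [inner_smul_left, hab, ← Complex.star_def]
    push_cast
    linear_combination (‖a‖ * ‖b‖ : ℂ) * hll
  have hsq : (‖a‖ + ‖b‖) ^ 2 ≤ ‖π (a + l • b) ξ‖ ^ 2 := by
    have h := norm_add_sq (𝕜 := ℂ) (l • π b ξ) (π a ξ)
    rw [hin, norm_smul, hl, one_mul, ha] at h
    have e : π (a + l • b) ξ = l • π b ξ + π a ξ := by
      rw [map_add, map_smul, add_comm]; rfl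
    rw [e, h]
    have : RCLike.re ((‖a‖ * ‖b‖ : ℝ) : ℂ) = ‖a‖ * ‖b‖ := Complex.ofReal_re _
    rw [this]
    nlinarith [norm_nonneg b]
  exact (le_of_sq_le_sq hsq (norm_nonneg _)).trans (hπ _)

/-- For `b ≠ 0`, divide `‖a‖ ^ 2 * ‖b‖ ^ 2 ≤ φ (star a * a) * ‖b‖ ^ 2` by `‖b‖ ^ 2`. For `b = 0` the
given state carries no information about `a` and is replaced by one norming `star a * a`. -/
lemma exists_isState_apply_star_mul_self_eq [Nontrivial A] {a b : A}
    (h : ∃ (φ : A →L[ℂ] ℂ) (l : ℂ), IsState φ ∧ ‖l‖ = 1 ∧ φ (star a * b) = l * ‖a‖ * ‖b‖) :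
    ∃ (φ : A →L[ℂ] ℂ) (l : ℂ), IsState φ ∧ ‖l‖ = 1 ∧ φ (star a * a) = ‖a‖ ^ 2 ∧
      φ (star a * b) = l * ‖a‖ * ‖b‖ := by
  obtain ⟨φ, l, hφ, hl, hab⟩ := h
  by_cases ha : a = 0
  · exact ⟨φ, l, hφ, hl, by simp [ha], hab⟩
  by_cases hb : b = 0
  · obtain ⟨ψ, hψ, hψa⟩ := exists_isState_apply_star_mul_self ha
    exact ⟨ψ, 1, hψ, by simp, hψa, by simp [hb]⟩
  have hbound (x : A) : ‖φ (star x * x)‖ ≤ ‖x‖ ^ 2 :=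
    (hφ.norm_apply_le _).trans_eq (by rw [CStarRing.norm_star_mul_self, sq])
  have hcs := hφ.norm_sq_apply_star_mul_le a b
  rw [hab] at hcs
  simp only [norm_mul, hl, one_mul, Complex.norm_real, norm_norm, mul_pow] at hcs
  have hre : ‖a‖ ^ 2 ≤ (φ (star a * a)).re := by
    refine le_of_mul_le_mul_right (hcs.trans ?_) (by positivity : 0 < ‖b‖ ^ 2)
    exact mul_le_mul_of_nonneg_left ((Complex.re_le_norm _).trans (hbound b))
      (Complex.nonneg_iff.1 (hφ.2 a)).1
  exact ⟨φ, l, hφ, hl, by simpa using eq_ofReal_of_norm_le_of_le_re (hbound a) hre, hab⟩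

end Parallel

end CStarParallel

/- In the third clause `inner ℂ (π b ξ) (π a ξ)` is `(π(a)ξ | π(b)ξ)`, the inner product `(· | ·)`
being linear in its first variable and Mathlib's in its second. A representation is a
⋆-homomorphism into the bounded operators of a Hilbert space, possibly degenerate. -/
theorem mainTheorem8 {A : Type u} [NonUnitalCStarAlgebra A] [Nontrivial A] (a b : A) :
    List.TFAE [
      CStarParallel.Parallel a b,
      ∃ (φ : A →L[ℂ] ℂ) (l : ℂ), CStarParallel.IsState φ ∧ ‖l‖ = 1 ∧
        φ (star a * b) = l * ‖a‖ * ‖b‖,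
      ∃ (H : Type (max u v)) (_ : NormedAddCommGroup H) (_ : InnerProductSpace ℂ H)
        (_ : CompleteSpace H) (π : A →⋆ₙₐ[ℂ] (H →L[ℂ] H)) (ξ : H) (l : ℂ),
        ‖ξ‖ = 1 ∧ ‖l‖ = 1 ∧ ‖π a ξ‖ = ‖a‖ ∧
          inner ℂ (π b ξ) (π a ξ) = l * ‖a‖ * ‖b‖] := by
  tfae_have 1 → 2 := CStarParallel.exists_isState_of_parallel
  tfae_have 2 → 3 := by
    intro h
    obtain ⟨φ, l, hφ, hl, haa, hab⟩ := CStarParallel.exists_isState_apply_star_mul_self_eq h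
    obtain ⟨H, _, _, _, π, ξ, hξ, hπ⟩ := hφ.exists_representation_ulift
    -- The third clause has the inner product in the opposite order, hence the conjugate scalar.
    refine ⟨H, inferInstance, inferInstance, inferInstance, π, ξ, star l, hξ,
      by rw [norm_star, hl], ?_, ?_⟩
    · have h₁ := hπ a a
      rw [haa, inner_self_eq_norm_sq_to_K] at h₁
      have h₂ : ‖π a ξ‖ ^ 2 = ‖a‖ ^ 2 := Complex.ofReal_injective (by simpa using h₁)
      exact (pow_left_inj₀ (norm_nonneg _) (norm_nonneg _) two_ne_zero).1 h₂
    · rw [← inner_conj_symm, hπ, hab]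
      simp
  tfae_have 3 → 1 := by
    rintro ⟨H, _, _, _, π, ξ, l, hξ, hl, ha, hab⟩
    exact CStarParallel.parallel_of_representation π hξ hl ha hab
  tfae_finish
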